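/- Let $G$ be a connected, locally finite (undirected) multigraph with a resistance $r(e)>0$ on every edge $e$. For a function $h:V(G)\to\mathbb{R}$, its energy is $\sum_{e=xy\in E(G)} (h(x)-h(y))^2/r(e)$, and $h$ is \emph{harmonic} if at every vertex $v$ the value $h(v)$ is the mean of the values of $h$ at the neighbours of $v$ weighted with the conductances $1/r(e)$ of the edges, that is, $$h(v)=\Big(\sum_{e=vw} 1/r(e)\Big)^{-1}\sum_{e=vw} h(w)/r(e).$$ A subnetwork $H$ of $(G,r)$ (a subgraph of $G$ with the restricted resistances) is \emph{transient} if for some vertex $v$ of $H$ there are a real $I\neq 0$ and an antisymmetric function $\varphi$ on the directed (non-loop) edges of $H$ such that the sum of $\varphi$ over the directed edges ending in $v$ is $I$, the sum of $\varphi$ over the directed edges ending in $w$ is $0$ for every vertex $w\neq v$ of $H$, and the energy $\sum_{e} r(e)\varphi(e)^2$ (sum over the non-loop edges $e$ of $H$, each with one of its two directions) is finite. Suppose that $F$ is a cut of $G$ (the set of all edges between $X$ and $Y$, for a partition of $V(G)$ into two non-empty sets $X$, $Y$) such that $\sum_{e\in F} 1/r(e)$ is finite, and that two distinct components of $G-F$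 each contain a transient subnetwork. Then $(G,r)$ is not in $\mathcal{O}_{HD}$, that is, $(G,r)$ admits a non-constant harmonic function of finite energy. -/

import Mathlib

/-- An electrical network `(G, r)`: a multigraph (parallel edges and loops are allowed) with a
positive resistance on every edge. Values of `resistance` outside the edge set play no role. -/
structure Network (α β : Type*) where
  graph : Graph α β
  resistance : β → ℝ
  resistance_pos : ∀ e ∈ graph.edgeSet, 0 < resistance e

/-- A multigraph is locally finite if every vertex is incident with only finitely many edges. -/
def Graph.IsLocallyFinite {α β : Type*} (G : Graph α β) : Prop :=
  ∀ v ∈ G.vertexSet, {e | G.Inc e v}.Finite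

/-- A multigraph is connected if it is non-empty and any two vertices are joined by a walk. -/
def Graph.IsConnectedGraph {α β : Type*} (G : Graph α β) : Prop :=
  G.vertexSet.Nonempty ∧
    ∀ x ∈ G.vertexSet, ∀ y ∈ G.vertexSet, Relation.ReflTransGen G.Adj x y

/-- A component of `G` is a maximal connected subgraph of `G`. -/
def Graph.IsComponentOf {α β : Type*} (C G : Graph α β) : Prop :=
  Maximal (fun K : Graph α β => K ≤ G ∧ K.IsConnectedGraph) C

/-- A cut of `G` is the set of all edges between the two classes of some bipartition of the
vertex set into non-empty classes. -/
def Graph.IsCut {α β : Type*} (G : Graph α β) (F : Set β) : Prop :=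
  ∃ X Y : Set α, X.Nonempty ∧ Y.Nonempty ∧ Disjoint X Y ∧ X ∪ Y = G.vertexSet ∧
    F = {e | ∃ x ∈ X, ∃ y ∈ Y, G.IsLink e x y}

/-- A directed edge `(e, x, y)`: the edge `e` has the two distinct ends `x` and `y`. -/
structure Graph.DirEdge {α β : Type*} (G : Graph α β) where
  edge : β
  source : α
  target : α
  isLink : G.IsLink edge source target
  source_ne_target : source ≠ target

/-- The directed edge `(e, y, x)` opposite to `(e, x, y)`. -/
def Graph.DirEdge.rev {α β : Type*} {G : Graph α β} (d : G.DirEdge) : G.DirEdge where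
  edge := d.edge
  source := d.target
  target := d.source
  isLink := d.isLink.symm
  source_ne_target := d.source_ne_target.symm

/-- Antisymmetric functions on the directed edges. -/
def Graph.IsAntisymmetric {α β : Type*} {G : Graph α β} (φ : G.DirEdge → ℝ) : Prop :=
  ∀ d, φ d = -φ d.rev

/-- The accumulation of `φ` at `v`: the sum of `φ` over all directed edges ending in `v`
(a finite sum when the graph is locally finite). -/
noncomputable def Graph.accumulation {α β : Type*} {G : Graph α β} (φ : G.DirEdge → ℝ)
    (v : α) : ℝ :=
  ∑ᶠ d ∈ {d : G.DirEdge | d.target = v}, φ d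

/-- `φ` is a `v`-flow of intensity `I`: it is antisymmetric, has accumulation `I` at `v`, and
satisfies Kirchhoff's node law at every other vertex. -/
def Graph.IsFlowAt {α β : Type*} {G : Graph α β} (φ : G.DirEdge → ℝ) (v : α) (I : ℝ) : Prop :=
  Graph.IsAntisymmetric φ ∧ Graph.accumulation φ v = I ∧
    ∀ w ∈ G.vertexSet, w ≠ v → Graph.accumulation φ w = 0

namespace Network

/-- The network has a locally finite underlying graph. -/
def IsLocallyFinite {α β : Type*} (N : Network α β) : Prop := N.graph.IsLocallyFinite

/-- The network has a connected underlying graph. -/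
def IsConnected {α β : Type*} (N : Network α β) : Prop := N.graph.IsConnectedGraph

/-- `M` is a subnetwork of `N`: a subgraph with the restricted resistances. -/
def IsSubnetwork {α β : Type*} (M N : Network α β) : Prop :=
  M.graph ≤ N.graph ∧ ∀ e ∈ M.graph.edgeSet, M.resistance e = N.resistance e

/-- The conductance `1 / r(e)`. -/
noncomputable def conductance {α β : Type*} (N : Network α β) (e : β) : ℝ :=
  1 / N.resistance e

/-- The energy `∑ₑ r(e) φ(e)²` of an antisymmetric function `φ`. Every edge that is not a loop
carries exactly two directed edges, with the same value of `φ²`, hence the factor `1 / 2`. -/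
noncomputable def energy {α β : Type*} (N : Network α β) (φ : N.graph.DirEdge → ℝ) :
    ENNReal :=
  (∑' d : N.graph.DirEdge, ENNReal.ofReal (N.resistance d.edge * φ d ^ 2)) / 2

/-- The function on the directed edges that is induced by a potential. -/
noncomputable def induced {α β : Type*} (N : Network α β) (h : α → ℝ) :
    N.graph.DirEdge → ℝ :=
  fun d => (h d.source - h d.target) / N.resistance d.edge

/-- A potential is harmonic if at every vertex `v` its value is the mean of its values at the
neighbours of `v`, weighted with the conductances of the edges joining `v` to them. The sums
range over the pairs `(e, w)` such that `e` joins `v` to `w`. -/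
def IsHarmonic {α β : Type*} (N : Network α β) (h : α → ℝ) : Prop :=
  ∀ v ∈ N.graph.vertexSet,
    h v = (∑ᶠ p ∈ {p : β × α | N.graph.IsLink p.1 v p.2}, N.conductance p.1)⁻¹ *
      ∑ᶠ p ∈ {p : β × α | N.graph.IsLink p.1 v p.2}, h p.2 * N.conductance p.1

/-- A network is in `O_HD` if every harmonic function of finite energy is constant. -/
def InOHD {α β : Type*} (N : Network α β) : Prop :=
  ∀ h : α → ℝ, N.IsHarmonic h → N.energy (N.induced h) ≠ ⊤ →
    ∀ x ∈ N.graph.vertexSet, ∀ y ∈ N.graph.vertexSet, h x = h y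

/-- A (locally finite) network is transient if for some vertex `v` there is a `v`-flow of
non-zero intensity with finite energy. -/
def IsTransient {α β : Type*} (N : Network α β) : Prop :=
  ∃ v ∈ N.graph.vertexSet, ∃ (I : ℝ) (φ : N.graph.DirEdge → ℝ),
    I ≠ 0 ∧ Graph.IsFlowAt φ v I ∧ N.energy φ ≠ ⊤

/-- The subgraph `C` of `N` contains a transient subnetwork of `N`. -/
def ContainsTransient {α β : Type*} (N : Network α β) (C : Graph α β) : Prop :=
  ∃ M : Network α β, M.IsSubnetwork N ∧ M.graph ≤ C ∧ M.IsTransient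

end Network

/-! ### Graphs: reachability, components, directed edges -/

namespace Graph

variable {α β : Type*} {G H C C₁ C₂ : Graph α β}

/-! Let `S` be the vertex set of `C₁`. Edges leaving `S` lie in `F`, so the indicator of `S` has
finite energy; let `g` be its gradient in the Hilbert space of square-summable functions on directed
edges. Let `K` be the closed span of the gradients of single-vertex indicators. By summation by
parts (`inner_eq_of_isAntisymmetric`), being orthogonal to these generators is Kirchhoff's node law,
so the component of `g` orthogonal to `K` is the gradient of a harmonic function of finite energy.

That function is non-constant once `g ∉ K`, and here transience enters (`not_inOHD_of_flows`).
Potential differences are continuous in the gradient, and pairing with a normalised flow from `v`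
recovers minus the value at `v` of any finitely supported potential. Combining this for the two
flows gives a continuous functional that vanishes on `K`. The flows stay inside the two components
and do not meet the support of `g`, so on `g` the functional is just the potential difference `1 -
0`. -/

theorem reflTransGen_adj_symm {x y : α} (h : Relation.ReflTransGen G.Adj x y) :
    Relation.ReflTransGen G.Adj y x := by
  induction h with
  | refl => exact .refl
  | tail _ hbc ih => exact .head hbc.symm ih

theorem reflTransGen_adj_mem {x y : α} (hx : x ∈ G.vertexSet)
    (h : Relation.ReflTransGen G.Adj x y) : y ∈ G.vertexSet := by
  induction h with
  | refl => exact hx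
  | tail _ hbc _ => exact hbc.right_mem

/-- A component is the subgraph induced by the set of vertices reachable from any of its
vertices. -/
theorem IsComponentOf.eq_induce (hC : C.IsComponentOf G) {x : α} (hx : x ∈ C.vertexSet) :
    C = G.induce {y | Relation.ReflTransGen G.Adj x y} := by
  obtain ⟨⟨hle, -, hconn⟩, hmax⟩ := hC
  have hxG : x ∈ G.vertexSet := hle.vertexSet_mono hx
  set S : Set α := {y | Relation.ReflTransGen G.Adj x y} with hS
  have hmono : ∀ y ∈ C.vertexSet, y ∈ S := fun y hy =>
    Relation.ReflTransGen.mono (fun _ _ (h : C.Adj _ _) => h.mono hle) _ _ (hconn x hx y hy)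
  have hle' : C ≤ G.induce S :=
    ⟨hmono, fun e a b h => ⟨h.mono hle, hmono a h.left_mem, hmono b h.right_mem⟩⟩
  have hreach : ∀ y ∈ S, Relation.ReflTransGen (G.induce S).Adj x y := by
    intro y hy
    induction hy with
    | refl => exact .refl
    | tail hab hbc ih =>
      obtain ⟨e, he⟩ := hbc
      exact ih.tail ⟨e, he, hab, hab.tail ⟨e, he⟩⟩
  -- The reachable set induces a connected subgraph containing `C`; maximality gives equality.
  refine le_antisymm hle' (hmax ⟨induce_le fun y hy => reflTransGen_adj_mem hxG hy,
    ⟨x, .refl⟩, fun a ha b hb => ?_⟩ hle')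
  exact (reflTransGen_adj_symm (hreach a ha)).trans (hreach b hb)

theorem IsComponentOf.disjoint_vertexSet (h₁ : C₁.IsComponentOf G) (h₂ : C₂.IsComponentOf G)
    (hne : C₁ ≠ C₂) : Disjoint C₁.vertexSet C₂.vertexSet :=
  Set.disjoint_left.2 fun _ hx₁ hx₂ => hne ((h₁.eq_induce hx₁).trans (h₂.eq_induce hx₂).symm)

theorem IsComponentOf.mem_of_isLink (hC : C.IsComponentOf G) {e : β} {x y : α}
    (hx : x ∈ C.vertexSet) (h : G.IsLink e x y) : y ∈ C.vertexSet := by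
  rw [hC.eq_induce hx]
  exact .single ⟨e, h⟩

theorem IsComponentOf.mem_of_isLink_of_notMem {F : Set β}
    (hC : C.IsComponentOf (G.deleteEdges F)) {e : β} {x y : α}
    (h : G.IsLink e x y) (hx : x ∈ C.vertexSet) (hy : y ∉ C.vertexSet) : e ∈ F := by
  by_contra he
  exact hy (hC.mem_of_isLink hx (by simpa using ⟨h, he⟩))

theorem DirEdge.ext' {d d' : G.DirEdge} (he : d.edge = d'.edge) (hs : d.source = d'.source) :
    d = d' := by
  cases d with | mk e x y h hn =>
  cases d' with | mk e' x' y' h' hn' =>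
  obtain rfl : e = e' := he
  obtain rfl : x = x' := hs
  obtain rfl : y = y' := h.right_unique h'
  rfl

theorem DirEdge.ext_target {d d' : G.DirEdge} (he : d.edge = d'.edge)
    (ht : d.target = d'.target) : d = d' :=
  DirEdge.ext' he (d.isLink.left_unique (by rw [he, ht]; exact d'.isLink))

/-- Reversal of directed edges as a permutation. -/
def DirEdge.revEquiv (G : Graph α β) : G.DirEdge ≃ G.DirEdge where
  toFun := rev
  invFun := rev
  left_inv _ := rfl
  right_inv _ := rfl

/-- A directed edge of a subgraph as a directed edge of the graph. -/
def DirEdge.map (hle : H ≤ G) (d : H.DirEdge) : G.DirEdge where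
  edge := d.edge
  source := d.source
  target := d.target
  isLink := d.isLink.mono hle
  source_ne_target := d.source_ne_target

theorem DirEdge.map_injective (hle : H ≤ G) : Function.Injective (DirEdge.map hle) :=
  fun _ _ h => DirEdge.ext'
    (congrArg (DirEdge.edge (G := G)) h) (congrArg (DirEdge.source (G := G)) h)

theorem IsLocallyFinite.finite_target (hG : G.IsLocallyFinite) (v : α) :
    {d : G.DirEdge | d.target = v}.Finite := by
  by_cases hv : v ∈ G.vertexSet
  · refine Set.Finite.of_finite_image (f := DirEdge.edge) ((hG v hv).subset ?_) ?_
    · rintro _ ⟨d, rfl, rfl⟩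
      exact d.isLink.inc_right
    · intro d hd d' hd' h
      exact DirEdge.ext_target h (hd.trans hd'.symm)
  · convert Set.finite_empty
    ext d
    simp only [Set.mem_ofPred_eq, Set.mem_empty_iff_false, iff_false]
    rintro rfl
    exact hv d.isLink.right_mem

theorem accumulation_of_notMem {φ : G.DirEdge → ℝ} {v : α} (hv : v ∉ G.vertexSet) :
    accumulation φ v = 0 := by
  refine finsum_mem_of_eqOn_zero fun d hd => ?_
  obtain rfl : d.target = v := hd
  exact absurd d.isLink.right_mem hv

/-- Summation by parts of an antisymmetric function against the indicator of a vertex. -/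
theorem IsAntisymmetric.hasSum_mul_indicator {φ : G.DirEdge → ℝ} (hφ : IsAntisymmetric φ)
    (hG : G.IsLocallyFinite) (v : α) :
    HasSum (fun d : G.DirEdge => φ d *
      (({v} : Set α).indicator 1 d.source - ({v} : Set α).indicator 1 d.target))
      (-2 * accumulation φ v) := by
  have hT : HasSum (fun d : G.DirEdge => φ d * ({v} : Set α).indicator 1 d.target)
      (accumulation φ v) := by
    rw [accumulation, finsum_mem_eq_finite_toFinset_sum _ (hG.finite_target v)]
    rw [Finset.sum_congr rfl (g := fun d : G.DirEdge =>
      φ d * ({v} : Set α).indicator 1 d.target) (fun d hd => ?_)]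
    · refine hasSum_sum_of_ne_finset_zero fun d hd => ?_
      have : d.target ≠ v := by simpa using hd
      simp [this]
    · have : d.target = v := by simpa using hd
      simp [this]
  -- Reversal turns the sum over edges into `v` into the sum over edges out of `v`, with opposite
  -- sign; hence the factor `-2`.
  have hS := (DirEdge.revEquiv G).hasSum_iff.2 hT
  rw [neg_mul, two_mul, neg_add']
  refine Eq.subst (motive := (HasSum · _)) (funext fun d => ?_) (hS.neg.sub hT)
  have h : φ (DirEdge.revEquiv G d) = - φ d := by rw [hφ d, neg_neg]; rfl
  rw [Function.comp_apply, h, mul_sub, neg_mul, neg_neg]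
  rfl

/-- The extension by zero of a function on the directed edges of a subgraph. -/
noncomputable def extendZero (hle : H ≤ G) (φ : H.DirEdge → ℝ) : G.DirEdge → ℝ :=
  Function.extend (DirEdge.map hle) φ 0

theorem extendZero_map (hle : H ≤ G) (φ : H.DirEdge → ℝ) (d : H.DirEdge) :
    extendZero hle φ (d.map hle) = φ d :=
  (DirEdge.map_injective hle).extend_apply _ _ _

theorem extendZero_of_notMem_range (hle : H ≤ G) (φ : H.DirEdge → ℝ) {d : G.DirEdge}
    (hd : d ∉ Set.range (DirEdge.map hle)) : extendZero hle φ d = 0 :=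
  Function.extend_apply' _ _ _ hd

theorem IsAntisymmetric.extendZero (hle : H ≤ G) {φ : H.DirEdge → ℝ} (hφ : IsAntisymmetric φ) :
    IsAntisymmetric (extendZero hle φ) := by
  intro d
  by_cases hd : d ∈ Set.range (DirEdge.map hle)
  · obtain ⟨d, rfl⟩ := hd
    rw [extendZero_map, hφ d]
    exact congrArg _ (extendZero_map hle φ d.rev).symm
  · rw [extendZero_of_notMem_range hle φ hd, extendZero_of_notMem_range, neg_zero]
    rintro ⟨d', h⟩
    exact hd ⟨d'.rev, congrArg DirEdge.rev h⟩

theorem accumulation_extendZero (hle : H ≤ G) (φ : H.DirEdge → ℝ) (v : α) :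
    accumulation (extendZero hle φ) v = accumulation φ v := by
  have himg : ∑ᶠ d ∈ DirEdge.map hle '' {d : H.DirEdge | d.target = v}, extendZero hle φ d =
      accumulation φ v := by
    rw [finsum_mem_image (DirEdge.map_injective hle).injOn]
    simp only [extendZero_map]
    rfl
  rw [← himg]
  refine finsum_mem_inter_support_eq _ _ _ (Set.ext fun d => and_congr_left fun hd => ?_)
  have hr : d ∈ Set.range (DirEdge.map hle) := by
    by_contra hr
    exact hd (extendZero_of_notMem_range hle φ hr)
  obtain ⟨d, rfl⟩ := hr
  rw [(DirEdge.map_injective hle).mem_set_image]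
  rfl

end Graph

/-! ### Potentials in the Hilbert space of square-summable functions -/

namespace Network

variable {α β : Type*} {N : Network α β}

theorem resistance_edge_pos (d : N.graph.DirEdge) : 0 < N.resistance d.edge :=
  N.resistance_pos _ d.isLink.edge_mem

/-- The Hilbert space of square-summable functions on the directed edges. -/
abbrev EdgeSpace (N : Network α β) : Type _ := lp (fun _ : N.graph.DirEdge => ℝ) 2

/-- `x` is the gradient of the potential `h`, scaled such that the square of its norm is twice the
energy of `h`. -/
def IsGradient (x : N.EdgeSpace) (h : α → ℝ) : Prop :=
  ∀ d, √(N.resistance d.edge) * x d = h d.source - h d.target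

theorem IsGradient.apply_eq {x : N.EdgeSpace} {h : α → ℝ} (hx : IsGradient x h)
    (d : N.graph.DirEdge) : x d = √(N.resistance d.edge) * N.induced h d := by
  have hr := resistance_edge_pos d
  have h0 := (Real.sqrt_pos.2 hr).ne'
  rw [induced, ← hx d, eq_comm, mul_div_assoc', div_eq_iff hr.ne', ← mul_assoc,
    Real.mul_self_sqrt hr.le, mul_comm]

theorem IsGradient.ext {x : N.EdgeSpace} {h : α → ℝ} (hx : IsGradient x h)
    (hc : ∀ v ∈ N.graph.vertexSet, ∀ w ∈ N.graph.vertexSet, h v = h w) : x = 0 := by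
  refine lp.ext (funext fun d => ?_)
  rw [hx.apply_eq, induced, hc _ d.isLink.left_mem _ d.isLink.right_mem]
  simp

theorem exists_edgeSpace_of_summable {φ : N.graph.DirEdge → ℝ}
    (h : Summable fun d => N.resistance d.edge * φ d ^ 2) :
    ∃ y : N.EdgeSpace, ∀ d, y d = √(N.resistance d.edge) * φ d := by
  refine ⟨⟨fun d => √(N.resistance d.edge) * φ d, memℓp_gen ?_⟩, fun d => rfl⟩
  refine h.congr fun d => ?_
  simp [mul_pow, Real.sq_sqrt (resistance_edge_pos d).le]

theorem exists_isGradient_of_summable {h : α → ℝ}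
    (hs : Summable fun d : N.graph.DirEdge =>
      (h d.source - h d.target) ^ 2 / N.resistance d.edge) :
    ∃ x : N.EdgeSpace, IsGradient x h := by
  obtain ⟨x, hx⟩ := exists_edgeSpace_of_summable (φ := N.induced h) (hs.congr fun d => by
    have := (resistance_edge_pos d).ne'
    rw [induced]
    field_simp)
  refine ⟨x, fun d => ?_⟩
  have hr := resistance_edge_pos d
  rw [hx, ← mul_assoc, Real.mul_self_sqrt hr.le, induced, mul_div_cancel₀ _ hr.ne']

theorem IsGradient.energy_ne_top {x : N.EdgeSpace} {h : α → ℝ} (hx : IsGradient x h) :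
    N.energy (N.induced h) ≠ ⊤ := by
  refine ENNReal.div_ne_top ?_ (by norm_num)
  refine Summable.tsum_ofReal_ne_top ?_
  have := (lp.memℓp x).summable (by norm_num)
  refine this.congr fun d => ?_
  simp [hx.apply_eq, mul_pow, Real.sq_sqrt (resistance_edge_pos d).le]

theorem summable_of_energy_ne_top {φ : N.graph.DirEdge → ℝ} (h : N.energy φ ≠ ⊤) :
    Summable fun d => N.resistance d.edge * φ d ^ 2 := by
  have h' : ∑' d : N.graph.DirEdge, ENNReal.ofReal (N.resistance d.edge * φ d ^ 2) ≠ ⊤ := by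
    intro h'
    exact h (by rw [energy, h', ENNReal.top_div_of_ne_top (by norm_num)])
  refine (ENNReal.summable_toReal h').congr fun d => ?_
  exact ENNReal.toReal_ofReal (mul_nonneg (resistance_edge_pos d).le (sq_nonneg _))

theorem exists_isGradient_indicator_singleton (hN : N.IsLocallyFinite) (v : α) :
    ∃ x : N.EdgeSpace, IsGradient x (({v} : Set α).indicator 1) := by
  refine exists_isGradient_of_summable ?_
  have hfin : ({d : N.graph.DirEdge | d.target = v} ∪
      Graph.DirEdge.revEquiv N.graph ⁻¹' {d : N.graph.DirEdge | d.target = v}).Finite :=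
    (hN.finite_target v).union ((hN.finite_target v).preimage (Equiv.injective _).injOn)
  refine summable_of_ne_finset_zero (s := hfin.toFinset) fun d hd => ?_
  rw [Set.Finite.mem_toFinset] at hd
  have ht : d.target ≠ v := fun h => hd (Or.inl h)
  have hs : d.source ≠ v := fun h => hd (Or.inr h)
  simp [ht, hs]

/-- On a network, the potential difference to a fixed vertex depends continuously on the
gradient. -/
theorem exists_continuousLinearMap_potential {o v : α}
    (h : Relation.ReflTransGen N.graph.Adj o v) :
    ∃ L : N.EdgeSpace →L[ℝ] ℝ, ∀ x h, IsGradient x h → L x = h v - h o := by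
  induction h with
  | refl => exact ⟨0, fun x h _ => by simp⟩
  | @tail b c _ hbc ih =>
    obtain ⟨L, hL⟩ := ih
    obtain ⟨e, he⟩ := hbc
    by_cases hne : b = c
    · exact hne ▸ ⟨L, hL⟩
    · refine ⟨L - √(N.resistance e) • lp.evalCLM ℝ (fun _ : N.graph.DirEdge => ℝ) 2
        ⟨e, b, c, he, hne⟩, fun x h hx => ?_⟩
      have := hx ⟨e, b, c, he, hne⟩
      have hev : lp.evalCLM ℝ (fun _ : N.graph.DirEdge => ℝ) 2 ⟨e, b, c, he, hne⟩ x =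
        x ⟨e, b, c, he, hne⟩ := rfl
      simp only [sub_apply, smul_apply, smul_eq_mul,
        hL x h hx, hev, this]
      ring

/-- A potential function on edge space, for a connected network. -/
theorem exists_potential (hN : N.IsConnected) :
    ∃ (o : α) (L : α → N.EdgeSpace →L[ℝ] ℝ),
      ∀ v ∈ N.graph.vertexSet, ∀ x h, IsGradient x h → L v x = h v - h o := by
  obtain ⟨⟨o, ho⟩, hc⟩ := hN
  have : ∀ v, ∃ L : N.EdgeSpace →L[ℝ] ℝ, v ∈ N.graph.vertexSet →
      ∀ x h, IsGradient x h → L x = h v - h o := by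
    intro v
    by_cases hv : v ∈ N.graph.vertexSet
    · obtain ⟨L, hL⟩ := exists_continuousLinearMap_potential (hc o ho v hv)
      exact ⟨L, fun _ => hL⟩
    · exact ⟨0, fun h => absurd h hv⟩
  choose L hL using this
  exact ⟨o, L, hL⟩

/-- The space of elements of edge space that are the gradients of the potential `v ↦ L v x`. -/
noncomputable def gradientSpace (L : α → N.EdgeSpace →L[ℝ] ℝ) : Submodule ℝ N.EdgeSpace :=
  ⨅ d : N.graph.DirEdge, (√(N.resistance d.edge) •
    lp.evalCLM ℝ (fun _ : N.graph.DirEdge => ℝ) 2 d - (L d.source - L d.target)).ker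

theorem mem_gradientSpace {L : α → N.EdgeSpace →L[ℝ] ℝ} {x : N.EdgeSpace} :
    x ∈ gradientSpace L ↔ IsGradient x fun v => L v x := by
  simp only [gradientSpace, Submodule.mem_iInf, LinearMap.mem_ker, IsGradient]
  refine forall_congr' fun d => ?_
  exact sub_eq_zero

/-- Closedness ensures that limits of gradients again come from a potential, so the projection onto
`K` does too. -/
theorem isClosed_gradientSpace (L : α → N.EdgeSpace →L[ℝ] ℝ) :
    IsClosed (gradientSpace L : Set N.EdgeSpace) := by
  rw [gradientSpace, Submodule.coe_iInf]
  exact isClosed_iInter fun d => ContinuousLinearMap.isClosed_ker _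

/-- The factors `√r` in `y` and `1/√r` in `x` cancel, leaving the summation by parts. It is used
both for the given flows and for the gradient of the harmonic function. -/
theorem inner_eq_of_isAntisymmetric (hN : N.IsLocallyFinite) {φ : N.graph.DirEdge → ℝ}
    (hφ : Graph.IsAntisymmetric φ) {x y : N.EdgeSpace}
    (hy : ∀ d, y d = √(N.resistance d.edge) * φ d) {v : α}
    (hx : IsGradient x (({v} : Set α).indicator 1)) :
    inner ℝ y x = -2 * Graph.accumulation φ v := by
  refine (lp.hasSum_inner y x).unique ?_
  refine Eq.subst (motive := (HasSum · _)) (funext fun d => ?_) (hφ.hasSum_mul_indicator hN v)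
  rw [← hx d, hy d, RCLike.inner_apply, conj_trivial]
  ring

/-- A potential satisfying Kirchhoff's node law is harmonic. -/
theorem isHarmonic_of_accumulation_eq_zero (hN : N.IsLocallyFinite) (hc : N.IsConnected)
    (hnt : N.graph.vertexSet.Nontrivial) {h : α → ℝ}
    (hh : ∀ v ∈ N.graph.vertexSet, Graph.accumulation (N.induced h) v = 0) :
    N.IsHarmonic h := by
  intro v hv
  set P : Set (β × α) := {p | N.graph.IsLink p.1 v p.2} with hP
  have hPfin : P.Finite := by
    refine Set.Finite.of_finite_image (f := Prod.fst) ((hN v hv).subset ?_) ?_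
    · rintro _ ⟨p, hp, rfl⟩
      exact hp.inc_left
    · rintro ⟨e, a⟩ ha ⟨e', b⟩ hb (rfl : e = e')
      exact Prod.ext rfl (ha.right_unique hb)
  have hacc : ∑ᶠ p ∈ P, (h p.2 * N.conductance p.1 - h v * N.conductance p.1) = 0 := by
    rw [← hh v hv, Graph.accumulation]
    have hbij : Set.BijOn (fun d : N.graph.DirEdge => (d.edge, d.source))
        {d | d.target = v} (P ∩ {p | p.2 ≠ v}) := by
      refine ⟨?_, fun d _ d' _ h => Graph.DirEdge.ext' (congrArg Prod.fst h)
        (congrArg Prod.snd h), ?_⟩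
      · rintro d rfl
        exact ⟨d.isLink.symm, d.source_ne_target⟩
      · rintro ⟨e, w⟩ ⟨he, hw⟩
        exact ⟨⟨e, w, v, he.symm, hw⟩, rfl, rfl⟩
    rw [finsum_mem_eq_of_bijOn _ hbij (f := N.induced h)
      (g := fun p => h p.2 * N.conductance p.1 - h v * N.conductance p.1)]
    -- Loops at `v` occur among the pairs but not among directed edges; their terms vanish.
    · refine finsum_mem_inter_support_eq _ _ _ (Set.ext fun p => and_congr_left fun hp => ?_)
      refine (and_iff_left fun hv => hp ?_).symm
      simp [hv]
    · rintro d rfl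
      rw [induced, conductance]
      ring
  rw [finsum_mem_sub_distrib _ _ hPfin, ← mul_finsum_mem, sub_eq_zero] at hacc
  -- A second vertex and connectedness force an edge at `v`, so the mean does not divide by zero.
  have hpos : 0 < ∑ᶠ p ∈ P, N.conductance p.1 := by
    obtain ⟨w, hw, hne⟩ := hnt.exists_ne v
    have hwalk := hc.2 v hv w hw
    obtain rfl | ⟨u, ⟨e, he⟩, -⟩ := hwalk.cases_head
    · exact absurd rfl hne
    rw [finsum_mem_eq_finite_toFinset_sum _ hPfin]
    refine Finset.sum_pos (fun p hp => ?_) ⟨(e, u), hPfin.mem_toFinset.2 he⟩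
    have hp : N.graph.IsLink p.1 v p.2 := hPfin.mem_toFinset.1 hp
    exact one_div_pos.2 (N.resistance_pos _ hp.edge_mem)
  rw [hacc, mul_comm (h v), inv_mul_cancel_left₀ hpos.ne']

end Network

/-! ### Non-constant harmonic functions from two transient subnetworks -/

namespace Network

variable {α β : Type*} {N : Network α β}

/-- A transient subnetwork carries a flow of the whole network. -/
theorem ContainsTransient.exists_flow {C : Graph α β} (hT : N.ContainsTransient C) :
    ∃ v ∈ C.vertexSet, ∃ I : ℝ, I ≠ 0 ∧ ∃ φ : N.graph.DirEdge → ℝ,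
      Graph.IsFlowAt φ v I ∧ (Summable fun d => N.resistance d.edge * φ d ^ 2) ∧
      ∀ d, φ d ≠ 0 → d.source ∈ C.vertexSet ∧ d.target ∈ C.vertexSet := by
  obtain ⟨M, ⟨hMN, hr⟩, hMC, v, hv, I, φ, hI, ⟨hanti, hacc, hnode⟩, hE⟩ := hT
  refine ⟨v, hMC.vertexSet_mono hv, I, hI, Graph.extendZero hMN φ,
    ⟨hanti.extendZero hMN, ?_, fun w _ hwv => ?_⟩, ?_, fun d hd => ?_⟩
  · rw [Graph.accumulation_extendZero, hacc]
  · rw [Graph.accumulation_extendZero]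
    by_cases hw : w ∈ M.graph.vertexSet
    · exact hnode w hw hwv
    · exact Graph.accumulation_of_notMem hw
  · refine ((Graph.DirEdge.map_injective hMN).summable_iff fun d hd => ?_).1
      ((summable_of_energy_ne_top hE).congr fun d => ?_)
    · rw [Graph.extendZero_of_notMem_range hMN φ hd]
      simp
    · rw [Function.comp_apply, Graph.extendZero_map, hr _ d.isLink.edge_mem]
      rfl
  · have hd' : d ∈ Set.range (Graph.DirEdge.map hMN) := by
      by_contra h
      exact hd (Graph.extendZero_of_notMem_range hMN φ h)
    obtain ⟨d, rfl⟩ := hd'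
    exact ⟨hMC.vertexSet_mono d.isLink.left_mem, hMC.vertexSet_mono d.isLink.right_mem⟩

/-- The indicator of a vertex set has finite energy if the edges leaving the set have finite
total conductance. -/
theorem exists_isGradient_indicator {F : Set β} {S : Set α}
    (hsum : Summable fun e : F => 1 / N.resistance e)
    (hS : ∀ e x y, N.graph.IsLink e x y → x ∈ S → y ∉ S → e ∈ F) :
    ∃ x : N.EdgeSpace, IsGradient x (S.indicator 1) := by
  refine exists_isGradient_of_summable ?_
  let P : Set N.graph.DirEdge := {d | d.source ∈ S ∧ d.target ∉ S}
  have h₁ : Summable (P.indicator fun d => 1 / N.resistance d.edge) := by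
    rw [← summable_subtype_iff_indicator]
    refine hsum.comp_injective (i := fun d : P =>
      (⟨d.1.edge, hS _ _ _ d.1.isLink d.2.1 d.2.2⟩ : F)) fun d d' h => ?_
    have he : d.1.edge = d'.1.edge := congrArg Subtype.val h
    refine Subtype.ext (Graph.DirEdge.ext' he ?_)
    -- An edge leaving `S` has only one of its two directions in `P`, so its edge determines it.
    refine ((he ▸ d.1.isLink).left_eq_or_eq d'.1.isLink).resolve_right fun h => d'.2.2 ?_
    exact h ▸ d.2.1
  refine (h₁.add ((Graph.DirEdge.revEquiv N.graph).summable_iff.2 h₁)).congr fun d => ?_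
  have hrev : (P.indicator (fun d => 1 / N.resistance d.edge) ∘
      Graph.DirEdge.revEquiv N.graph) d =
      P.indicator (fun d => 1 / N.resistance d.edge) d.rev := rfl
  rw [hrev]
  by_cases hs : d.source ∈ S <;> by_cases ht : d.target ∈ S <;>
    simp [P, Set.indicator, Graph.DirEdge.rev, hs, ht]

/-- If the indicator of a vertex set `S` has finite energy, and there are two flows of finite
energy from vertices inside and outside of `S` which do not use edges leaving `S`, then the network
admits a non-constant harmonic function of finite energy. -/
theorem not_inOHD_of_flows (hc : N.IsConnected) (hN : N.IsLocallyFinite) {S : Set α}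
    {g : N.EdgeSpace} (hg : IsGradient g (S.indicator 1)) {v₁ v₂ : α}
    (hv₁ : v₁ ∈ N.graph.vertexSet) (hv₂ : v₂ ∈ N.graph.vertexSet) (hvS₁ : v₁ ∈ S) (hvS₂ : v₂ ∉ S)
    {I₁ I₂ : ℝ} (hI₁ : I₁ ≠ 0) (hI₂ : I₂ ≠ 0) {φ₁ φ₂ : N.graph.DirEdge → ℝ}
    (hφ₁ : Graph.IsFlowAt φ₁ v₁ I₁) (hφ₂ : Graph.IsFlowAt φ₂ v₂ I₂)
    (hE₁ : Summable fun d => N.resistance d.edge * φ₁ d ^ 2)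
    (hE₂ : Summable fun d => N.resistance d.edge * φ₂ d ^ 2)
    (hS₁ : ∀ d, φ₁ d ≠ 0 → (d.source ∈ S ↔ d.target ∈ S))
    (hS₂ : ∀ d, φ₂ d ≠ 0 → (d.source ∈ S ↔ d.target ∈ S)) :
    ¬ N.InOHD := by
  intro hOHD
  obtain ⟨o, L, hL⟩ := exists_potential hc
  choose δ hδ using exists_isGradient_indicator_singleton hN
  obtain ⟨y₁, hy₁⟩ := exists_edgeSpace_of_summable hE₁
  obtain ⟨y₂, hy₂⟩ := exists_edgeSpace_of_summable hE₂
  have hgrad : ∀ {x h}, IsGradient x h → x ∈ gradientSpace L := by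
    intro x h hx
    refine mem_gradientSpace.2 fun d => ?_
    beta_reduce
    rw [hx d, hL _ d.isLink.left_mem x h hx, hL _ d.isLink.right_mem x h hx]
    ring
  have hflow : ∀ {φ : N.graph.DirEdge → ℝ} {y : N.EdgeSpace},
      (∀ d, y d = √(N.resistance d.edge) * φ d) →
      (∀ d, φ d ≠ 0 → (d.source ∈ S ↔ d.target ∈ S)) → inner ℝ y g = 0 := by
    intro φ y hy hS
    rw [lp.inner_eq_tsum]
    refine (tsum_congr fun d => ?_).trans tsum_zero
    by_cases hd : φ d = 0
    · simp [hy, hd]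
    · have h0 : (S.indicator 1 d.source : ℝ) - S.indicator 1 d.target = 0 := by
        by_cases ht : d.target ∈ S
        · simp [ht, (hS d hd).2 ht]
        · simp [ht, mt (hS d hd).1 ht]
      rw [hg.apply_eq, induced, h0]
      simp
  -- Since `⟪yᵢ, δ v⟫` is `-2 * Iᵢ` if `v = vᵢ` and `0` otherwise, the weights `(2 * Iᵢ)⁻¹` make the
  -- flow terms cancel the potential difference on every `δ v`.
  let Λ : N.EdgeSpace →L[ℝ] ℝ := L v₁ - L v₂ +
    ((2 * I₁)⁻¹ • innerSL ℝ y₁ - (2 * I₂)⁻¹ • innerSL ℝ y₂)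
  have hΛ : ∀ x, Λ x = L v₁ x - L v₂ x +
    ((2 * I₁)⁻¹ * inner ℝ y₁ x - (2 * I₂)⁻¹ * inner ℝ y₂ x) := fun x => rfl
  have hΛg : Λ g = 1 := by
    rw [hΛ, hL v₁ hv₁ g _ hg, hL v₂ hv₂ g _ hg, hflow hy₁ hS₁, hflow hy₂ hS₂]
    simp [hvS₁, hvS₂]
  have hΛδ : ∀ v ∈ N.graph.vertexSet, Λ (δ v) = 0 := by
    intro v hv
    have hinner : ∀ {φ : N.graph.DirEdge → ℝ} {y : N.EdgeSpace} {u : α} {I : ℝ}, I ≠ 0 →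
        (∀ d, y d = √(N.resistance d.edge) * φ d) → Graph.IsFlowAt φ u I →
        (2 * I)⁻¹ * inner ℝ y (δ v) = -({v} : Set α).indicator 1 u := by
      intro φ y u I hI hy hφ
      rw [inner_eq_of_isAntisymmetric hN hφ.1 hy (hδ v)]
      by_cases huv : v = u
      · subst huv
        rw [hφ.2.1]
        simp
        field_simp
      · rw [hφ.2.2 v hv huv]
        simp [Ne.symm huv]
    rw [hΛ, hL v₁ hv₁ _ _ (hδ v), hL v₂ hv₂ _ _ (hδ v), hinner hI₁ hy₁ hφ₁, hinner hI₂ hy₂ hφ₂]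
    ring
  let K : Submodule ℝ N.EdgeSpace :=
    (Submodule.span ℝ (δ '' N.graph.vertexSet)).topologicalClosure
  have : CompleteSpace K := (Submodule.isClosed_topologicalClosure _).completeSpace_coe
  have hKΛ : K ≤ Λ.ker := by
    refine Submodule.topologicalClosure_minimal _ (Submodule.span_le.2 ?_) Λ.isClosed_ker
    rintro _ ⟨v, hv, rfl⟩
    exact hΛδ v hv
  have hKL : K ≤ gradientSpace L := by
    refine Submodule.topologicalClosure_minimal _ (Submodule.span_le.2 ?_)
      (isClosed_gradientSpace L)
    rintro _ ⟨v, hv, rfl⟩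
    exact hgrad (hδ v)
  -- `g - u` is the harmonic part in the Royden decomposition of `g`; it is non-zero because `Λ` is
  -- `1` on `g` and `0` on `K`.
  set u := K.starProjection g with hu
  have huK : u ∈ K := K.starProjection_apply_mem g
  have hw : IsGradient (g - u) fun v => L v (g - u) :=
    mem_gradientSpace.1 (sub_mem (hgrad hg) (hKL huK))
  have hw0 : g - u ≠ 0 := by
    intro h0
    have h1 : Λ (g - u) = 1 := by
      rw [map_sub, hΛg, show Λ u = 0 from hKΛ huK, sub_zero]
    rw [h0, map_zero] at h1
    exact zero_ne_one h1
  refine hw0 (hw.ext (hOHD _ ?_ hw.energy_ne_top))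
  refine isHarmonic_of_accumulation_eq_zero hN hc
    ⟨v₁, hv₁, v₂, hv₂, fun h => hvS₂ (h ▸ hvS₁)⟩ fun v hv => ?_
  have hanti : Graph.IsAntisymmetric (N.induced fun v => L v (g - u)) := fun d => by
    simp only [induced, Graph.DirEdge.rev]
    ring
  have hδK : δ v ∈ K :=
    Submodule.le_topologicalClosure _ (Submodule.subset_span ⟨v, hv, rfl⟩)
  have h := K.starProjection_inner_eq_zero g (δ v) hδK
  rw [← hu, inner_eq_of_isAntisymmetric hN hanti hw.apply_eq (hδ v)] at h
  linarith

end Network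

theorem mainTheorem3 {α β : Type*} (N : Network α β)
    (hconn : N.IsConnected) (hfin : N.IsLocallyFinite)
    (F : Set β) (hF : N.graph.IsCut F)
    (hsum : Summable (fun e : F => 1 / N.resistance e))
    (C₁ C₂ : Graph α β)
    (hC₁ : C₁.IsComponentOf (N.graph.deleteEdges F))
    (hC₂ : C₂.IsComponentOf (N.graph.deleteEdges F))
    (hne : C₁ ≠ C₂)
    (hT₁ : N.ContainsTransient C₁) (hT₂ : N.ContainsTransient C₂) :
    ¬ N.InOHD := by
  have hdisj := Set.disjoint_right.1 (hC₁.disjoint_vertexSet hC₂ hne)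
  have hV₁ := (hC₁.1.1.trans Graph.deleteEdges_le).vertexSet_mono
  have hV₂ := (hC₂.1.1.trans Graph.deleteEdges_le).vertexSet_mono
  obtain ⟨g, hg⟩ := Network.exists_isGradient_indicator (S := C₁.vertexSet) hsum
    fun e x y h hx hy => hC₁.mem_of_isLink_of_notMem h hx hy
  obtain ⟨v₁, hv₁, I₁, hI₁, φ₁, hφ₁, hE₁, hS₁⟩ := hT₁.exists_flow
  obtain ⟨v₂, hv₂, I₂, hI₂, φ₂, hφ₂, hE₂, hS₂⟩ := hT₂.exists_flow
  -- Both ends of any edge carrying `φ₁` lie in `S`; both ends of any edge carrying `φ₂` lie outside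
  -- it.
  exact Network.not_inOHD_of_flows hconn hfin hg (hV₁ hv₁) (hV₂ hv₂) hv₁ (hdisj hv₂) hI₁ hI₂
    hφ₁ hφ₂ hE₁ hE₂ (fun d hd => iff_of_true (hS₁ d hd).1 (hS₁ d hd).2)
    fun d hd => iff_of_false (hdisj (hS₂ d hd).1) (hdisj (hS₂ d hd).2)
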